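/- Let $k\ge 0$, let $\omega((x,y),(x',y'))=\langle x,y'\rangle-\langle y,x'\rangle$ be the standard symplectic form on $\mathbb R^{2k}=\mathbb R^k\times\mathbb R^k$, and let $J(x,y)=(-y,x)$. Let $\Lambda(k)$ be the set of Lagrangian subspaces of $(\mathbb R^{2k},\omega)$ with the gap metric $d(L,L')=\|P_L-P_{L'}\|$, where $P_L$ is the orthogonal projection onto $L$. Let $[a,b]$ be a compact interval and let $(V,W):[a,b]\to\Lambda(k)\times\Lambda(k)$ be a continuous pair of paths with transversal ends, that is, $V(a)+W(a)=\mathbb R^{2k}=V(b)+W(b)$. The $\mathbb Z_2$-index $\iota(V(t),W(t);t\in[a,b])$ is defined as follows: choose continuous frames $v_1(t),\dots,v_k(t)$ of $V(t)$ and $w_1(t),\dots,w_k(t)$ of $W(t)$ and put $M(t)=[v_1(t)|\cdots|v_k(t)|w_1(t)|\cdots|w_k(t)]$; the index is $0$ if $\det(M(a)M(b))>0$ and $1$ if $\det(M(a)M(b))<0$. The Cappell–Lee–Miller Maslov index $\iota^{\rm CLM}(V(t),W(t);t\in[a,b])\in\mathbb Z$, the signed count with multiplicity of the intersections of $V$ and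 $W$, is defined as follows: choose a subdivision $a=t_0\le t_1\le\dots\le t_n=b$ and numbers $\varepsilon_0,\dots,\varepsilon_{n-1}\in(0,\pi)$ such that $V(s)\cap e^{-\varepsilon_j J}W(s)=0$ for all $s\in[t_j,t_{j+1}]$ and $0\le j<n$; then $$\iota^{\rm CLM}=\sum_{j=0}^{n-1}\bigl(c(t_{j+1},\varepsilon_j)-c(t_j,\varepsilon_j)\bigr),\qquad c(s,\varepsilon)=\sum_{0<\theta<\varepsilon}\dim\bigl(V(s)\cap e^{-\theta J}W(s)\bigr).$$ Then both indices are well defined (the required choices exist, and the value does not depend on them), and $$\iota(V(t),W(t);t\in[a,b])\equiv\iota^{\rm CLM}(V(t),W(t);t\in[a,b])\pmod 2 .$$ -/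

import Mathlib

open Set

noncomputable section

namespace LagrangianPaths

/-- The Euclidean space `ℝ^(k+l)`, with coordinates indexed by `Fin k ⊕ Fin l`.  For `l = k` it is
`ℝ^{2k}` with points written `(x, y)`, where `x` is the `inl` part and `y` the `inr` part. -/
abbrev Space (k l : ℕ) : Type := EuclideanSpace ℝ (Fin k ⊕ Fin l)

/-- The standard complex structure of `ℝ^{2k}`, `J (x, y) = (-y, x)`. -/
def J (k : ℕ) : Space k k →ₗ[ℝ] Space k k := Matrix.toEuclideanLin (Matrix.J (Fin k) ℝ)

/-- The standard symplectic form of `ℝ^{2k}`, `ω ((x, y), (x', y')) = ∑ (x_j y'_j - y_j x'_j)`. -/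
def omega {k : ℕ} (u v : Space k k) : ℝ :=
  ∑ j : Fin k, (u (Sum.inl j) * v (Sum.inr j) - u (Sum.inr j) * v (Sum.inl j))

/-- A subspace is Lagrangian if it equals its own symplectic orthogonal. -/
def IsLagrangian {k : ℕ} (L : Submodule ℝ (Space k k)) : Prop :=
  ∀ u : Space k k, u ∈ L ↔ ∀ v ∈ L, omega u v = 0

/-- The Lagrangian Grassmannian `Λ(k)` of `(ℝ^{2k}, ω)`. -/
def Lag (k : ℕ) : Type := {L : Submodule ℝ (Space k k) // IsLagrangian L}

/-- The subspace underlying a point of `Λ(k)`. -/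
def Lag.toSubspace {k : ℕ} (L : Lag k) : Submodule ℝ (Space k k) := L.1

/-- `Λ(k)` carries the gap metric `d(L, L') = ‖P_L - P_{L'}‖`, where `P_L` is the orthogonal
projection of `ℝ^{2k}` onto `L`, and the norm is the operator norm. -/
instance (k : ℕ) : MetricSpace (Lag k) :=
  MetricSpace.induced (fun L : Lag k => L.toSubspace.starProjection)
    (fun _ _ h => Subtype.ext (Submodule.starProjection_inj.1 h)) inferInstance

/-- Transversality of two subspaces: their sum is the whole space. -/
def Transversal {k l : ℕ} (V W : Submodule ℝ (Space k l)) : Prop := V ⊔ W = ⊤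

/-! ### The `ℤ₂`-index -/

/-- `v` is a frame (an ordered basis) of the subspace `V`. -/
def IsFrame {k l r : ℕ} (v : Fin r → Space k l) (V : Submodule ℝ (Space k l)) : Prop :=
  LinearIndependent ℝ v ∧ Submodule.span ℝ (Set.range v) = V

/-- The square matrix `[v_1 | ⋯ | v_k | w_1 | ⋯ | w_l]` with the given columns. -/
def frameMatrix {k l : ℕ} (v : Fin k → Space k l) (w : Fin l → Space k l) :
    Matrix (Fin k ⊕ Fin l) (Fin k ⊕ Fin l) ℝ :=
  Matrix.of fun r c => (Sum.elim v w c) r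

/-- `i` is the `ℤ₂`-index of the pair of paths `V`, `W` of subspaces (of dimensions `k` and `l`) of
`ℝ^(k+l)`: for some continuous frames of `V` and `W`, with `M` the path of matrices that they form,
`i = 0` and `det (M(a) M(b)) > 0`, or `i = 1` and `det (M(a) M(b)) < 0`. -/
def IsZ2Index {k l : ℕ} {a b : ℝ} (hab : a ≤ b)
    (V W : Set.Icc a b → Submodule ℝ (Space k l)) (i : ℤ) : Prop :=
  ∃ (v : Set.Icc a b → Fin k → Space k l) (w : Set.Icc a b → Fin l → Space k l),
    Continuous v ∧ Continuous w ∧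
    (∀ t, IsFrame (v t) (V t)) ∧ (∀ t, IsFrame (w t) (W t)) ∧
    ((0 < (frameMatrix (v ⟨a, left_mem_Icc.2 hab⟩) (w ⟨a, left_mem_Icc.2 hab⟩) *
          frameMatrix (v ⟨b, right_mem_Icc.2 hab⟩) (w ⟨b, right_mem_Icc.2 hab⟩)).det ∧ i = 0) ∨
     ((frameMatrix (v ⟨a, left_mem_Icc.2 hab⟩) (w ⟨a, left_mem_Icc.2 hab⟩) *
          frameMatrix (v ⟨b, right_mem_Icc.2 hab⟩) (w ⟨b, right_mem_Icc.2 hab⟩)).det < 0 ∧ i = 1))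

/-! ### The Maslov index of a pair of Lagrangian paths -/

/-- The rotation `e^{θJ} = cos θ + sin θ J` (recall `J² = -1`). -/
def rot {k : ℕ} (θ : ℝ) : Space k k →ₗ[ℝ] Space k k :=
  Real.cos θ • LinearMap.id + Real.sin θ • J k

/-- The rotated subspace `e^{-θJ} W`. -/
def rotated {k : ℕ} (θ : ℝ) (W : Submodule ℝ (Space k k)) : Submodule ℝ (Space k k) :=
  W.map (rot (-θ))

/-- The number, with multiplicity, of angles `θ ∈ (0, ε)` at which `e^{-θJ} W` meets `V`:
`∑_{0 < θ < ε} dim (V ∩ e^{-θJ} W)`.  For Lagrangian `V`, `W` and `ε ≤ π` only finitely many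
terms are nonzero. -/
def angleCount {k : ℕ} (V W : Submodule ℝ (Space k k)) (ε : ℝ) : ℕ :=
  ∑ᶠ θ ∈ Set.Ioo (0 : ℝ) ε, Module.finrank ℝ ↥(V ⊓ rotated θ W)

/-- `m` is the Cappell-Lee-Miller Maslov index of the pair of Lagrangian paths `V`, `W`, as the
spectral flow of the angles (modulo `π`) between `V` and `W` through `0`.  The angles of the pair
at time `s` are the `θ` with `V(s) ∩ e^{-θJ} W(s) ≠ 0`, with the dimension of this intersection as
multiplicity; the angle `0` is an intersection of `V(s)` and `W(s)`.  Take a subdivision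
`a = t_0 ≤ ⋯ ≤ t_n = b` and levels `ε_j ∈ (0, π)` such that `ε_j` is not an angle of the pair at any
time in `[t_j, t_{j+1}]`; on this interval the signed number of angles that pass through `0` is the
change of the number of angles in `(0, ε_j)`, and `m` is the sum of these changes.  The open end at
`0` is the Cappell-Lee-Miller convention of counting endpoints after a small rotation `e^{-δJ}` of
`W`, so that `(ℝ, e^{sJ} ℝ)` has index `1` on `[-π/4, π/4]` and `[0, π/4]`, and `0` on
`[-π/4, 0]`. -/
def IsMaslovIndexCLM {k : ℕ} {a b : ℝ} (hab : a ≤ b)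
    (V W : Set.Icc a b → Submodule ℝ (Space k k)) (m : ℤ) : Prop :=
  ∃ (n : ℕ) (t : ℕ → Set.Icc a b) (ε : ℕ → ℝ),
    Monotone t ∧ t 0 = ⟨a, left_mem_Icc.2 hab⟩ ∧ t n = ⟨b, right_mem_Icc.2 hab⟩ ∧
    (∀ j < n, 0 < ε j ∧ ε j < Real.pi ∧
      ∀ s, t j ≤ s → s ≤ t (j + 1) → V s ⊓ rotated (ε j) (W s) = ⊥) ∧
    m = ∑ j ∈ Finset.range n,
      ((angleCount (V (t (j + 1))) (W (t (j + 1))) (ε j) : ℤ)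
        - (angleCount (V (t j)) (W (t j)) (ε j) : ℤ))

end LagrangianPaths

end

noncomputable section

namespace LagrangianPaths

open scoped RealInnerProductSpace Topology

variable {k : ℕ}

/-! Everything rests on a normal form for two Lagrangians `V`, `W` (`exists_isAngleFrame`): an
orthonormal basis `e_j` of `V` and angles `θ_j ∈ [0, π)` such that the vectors `e^{θ_j J} e_j` form
a basis of `W`. Then `V ∩ e^{-tJ} W` is spanned by the `e_j` with `θ_j = t`, and `det [v | e^{-tJ}
w] = K ∏ sin (θ_j - t)` with `K ≠ 0`.

Parity: as `ε` varies in `(0, π)`, this determinant changes sign once for each angle passed, so its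
sign times `(-1)^{c(s, ε)}` depends only on `s` (`exists_sign`), and at a transversal time it is the
sign of `det [v | w]`. On a piece of the subdivision the determinant at level `ε_j` never vanishes,
so its sign is constant there; multiplying over the pieces gives `sign det (M(a) M(b)) = (-1)^m`.
This holds for all continuous frames and all subdivisions, so it also shows that the `ℤ₂`-index does
not depend on the frames.

Independence of the Maslov index from the subdivision needs integers, not parities. The number of
angles between two levels is the negative index of a continuous family of quadratic forms, hence
locally constant while the levels are not angles (`continuousAt_angleCount_sub`). Therefore the
local counts glue to one function `F : [a, b] → ℤ`, and every subdivision computes `F(b) - F(a)`. -/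

lemma J_apply_inl (u : Space k k) (j : Fin k) : J k u (Sum.inl j) = -u (Sum.inr j) := by
  simp [J, Matrix.J, Matrix.toEuclideanLin, Matrix.toLin'_apply, Matrix.mulVec, dotProduct,
    Matrix.one_apply]

lemma J_apply_inr (u : Space k k) (j : Fin k) : J k u (Sum.inr j) = u (Sum.inl j) := by
  simp [J, Matrix.J, Matrix.toEuclideanLin, Matrix.toLin'_apply, Matrix.mulVec, dotProduct,
    Matrix.one_apply]

@[simp] lemma J_J (u : Space k k) : J k (J k u) = -u := by
  ext i
  rcases i with j | j <;> simp [J_apply_inl, J_apply_inr]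

lemma inner_J_left (u v : Space k k) : ⟪J k u, v⟫ = omega u v := by
  simp only [PiLp.inner_apply, Fintype.sum_sum_type, J_apply_inl, J_apply_inr, omega,
    ← Finset.sum_add_distrib]
  refine Finset.sum_congr rfl fun j _ => ?_
  simp
  ring

lemma omega_swap (u v : Space k k) : omega u v = -omega v u := by
  simp only [omega, ← Finset.sum_neg_distrib]
  exact Finset.sum_congr rfl fun j _ => by ring

lemma inner_J_right (u v : Space k k) : ⟪u, J k v⟫ = -⟪J k u, v⟫ := by
  rw [real_inner_comm, inner_J_left, inner_J_left, omega_swap]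

lemma inner_J_J (u v : Space k k) : ⟪J k u, J k v⟫ = ⟪u, v⟫ := by
  rw [inner_J_right, J_J, inner_neg_left, neg_neg]

lemma rot_apply (t : ℝ) (u : Space k k) :
    rot t u = Real.cos t • u + Real.sin t • J k u := by
  simp [rot]

lemma rot_rot (s t : ℝ) (u : Space k k) : rot s (rot t u) = rot (s + t) u := by
  simp only [rot_apply, map_add, map_smul, J_J, Real.cos_add, Real.sin_add]
  module

lemma rot_zero (u : Space k k) : rot 0 u = u := by simp [rot_apply]

lemma rot_neg_rot (t : ℝ) (u : Space k k) : rot (-t) (rot t u) = u := by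
  rw [rot_rot, neg_add_cancel, rot_zero]

lemma rot_injective (t : ℝ) : Function.Injective (rot t : Space k k →ₗ[ℝ] Space k k) :=
  Function.LeftInverse.injective (rot_neg_rot t)

lemma rotated_zero (W : Submodule ℝ (Space k k)) : rotated 0 W = W := by
  have : (rot (-0) : Space k k →ₗ[ℝ] Space k k) = LinearMap.id := by
    ext1 u; simp [rot_zero]
  rw [rotated, this, Submodule.map_id]

/-! ### Lagrangian subspaces and their orthogonal projections -/

namespace IsLagrangian

variable {L V W : Submodule ℝ (Space k k)}

lemma mem_iff (hL : IsLagrangian L) (u : Space k k) : u ∈ L ↔ J k u ∈ Lᗮ := by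
  rw [hL u, Submodule.mem_orthogonal']
  simp only [inner_J_left]

lemma mem_orthogonal_iff (hL : IsLagrangian L) (u : Space k k) : u ∈ Lᗮ ↔ J k u ∈ L := by
  rw [hL.mem_iff, J_J, neg_mem_iff]

lemma inner_J_eq_zero (hL : IsLagrangian L) {u v : Space k k} (hu : u ∈ L) (hv : v ∈ L) :
    ⟪u, J k v⟫ = 0 :=
  (Submodule.mem_orthogonal _ _).1 ((hL.mem_iff v).1 hv) u hu

/-- `J` exchanges `L` and `Lᗮ`, so it intertwines the projection `P` with `1 - P`. -/
lemma starProjection_J (hL : IsLagrangian L) (u : Space k k) :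
    L.starProjection (J k u) = J k u - J k (L.starProjection u) := by
  refine (Submodule.eq_starProjection_of_mem_orthogonal (K := L)
    (v := J k u - J k (L.starProjection u)) ?_ ?_)
  · rw [← map_sub, ← hL.mem_orthogonal_iff]
    exact Submodule.sub_starProjection_mem_orthogonal (K := L) u
  · rw [sub_sub_cancel, ← hL.mem_iff]
    exact Submodule.starProjection_apply_mem L u

lemma orthogonal_eq_map (hL : IsLagrangian L) : Lᗮ = L.map (J k) := by
  ext u
  rw [hL.mem_orthogonal_iff, Submodule.mem_map]
  refine ⟨fun h => ⟨-J k u, neg_mem h, by simp⟩, ?_⟩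
  rintro ⟨v, hv, rfl⟩
  rw [J_J]
  exact neg_mem hv

lemma finrank_eq (hL : IsLagrangian L) : Module.finrank ℝ L = k := by
  have hinj : Function.Injective (J k) := by
    intro u v h
    have := congrArg (J k) h
    simpa using this
  have h1 : Module.finrank ℝ Lᗮ = Module.finrank ℝ L := by
    rw [hL.orthogonal_eq_map]
    exact (Submodule.equivMapOfInjective _ hinj L).finrank_eq.symm
  have h2 := Submodule.finrank_add_finrank_orthogonal L
  have h3 : Module.finrank ℝ (Space k k) = k + k := by simp
  omega

end IsLagrangian

/-! ### Angles between two Lagrangians -/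

/-- `e` is an orthonormal basis of `V` such that the vectors `e^{θ_j J} e_j`, with angles `θ_j` in
`[0, π)`, form a basis of `W`. -/
structure IsAngleFrame (V W : Submodule ℝ (Space k k)) (e : Fin k → Space k k)
    (θ : Fin k → ℝ) : Prop where
  orthonormal : Orthonormal ℝ e
  span_eq : Submodule.span ℝ (range e) = V
  nonneg : ∀ j, 0 ≤ θ j
  lt_pi : ∀ j, θ j < Real.pi
  span_rot_eq : Submodule.span ℝ (range fun j => rot (θ j) (e j)) = W

/-- Two commuting symmetric operators have an orthonormal basis of joint eigenvectors. -/
lemma exists_orthonormalBasis_of_commute {E : Type*} [NormedAddCommGroup E]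
    [InnerProductSpace ℝ E] [FiniteDimensional ℝ E] {X Y : E →ₗ[ℝ] E} (hX : X.IsSymmetric)
    (hY : Y.IsSymmetric) (hXY : Commute X Y) {n : ℕ} (hn : Module.finrank ℝ E = n) :
    ∃ e : OrthonormalBasis (Fin n) ℝ E, ∃ x y : Fin n → ℝ,
      ∀ j, X (e j) = x j • e j ∧ Y (e j) = y j • e j := by
  classical
  have hint := LinearMap.IsSymmetric.directSum_isInternal_of_commute hX hY hXY
  have horth := LinearMap.IsSymmetric.orthogonalFamily_eigenspace_inf_eigenspace hX hY
  let b := hint.collectedBasis (fun i => (stdOrthonormalBasis ℝ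
    (Module.End.eigenspace X i.2 ⊓ Module.End.eigenspace Y i.1 : Submodule ℝ E)).toBasis)
  have hb : Orthonormal ℝ b := by
    have := horth.orthonormal_sigma_orthonormal (v_family := fun i => (stdOrthonormalBasis ℝ
      (Module.End.eigenspace X i.2 ⊓ Module.End.eigenspace Y i.1 : Submodule ℝ E)).toBasis)
      (by simp)
    simpa [b, hint.collectedBasis_coe] using! this
  have : Fintype (Σ i : ℝ × ℝ, Fin (Module.finrank ℝ
    (Module.End.eigenspace X i.2 ⊓ Module.End.eigenspace Y i.1 : Submodule ℝ E))) :=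
    FiniteDimensional.fintypeBasisIndex b
  let f := Fintype.equivFinOfCardEq ((Module.finrank_eq_card_basis b).symm.trans hn)
  refine ⟨(b.toOrthonormalBasis hb).reindex f, fun j => (f.symm j).1.2,
    fun j => (f.symm j).1.1, fun j => ?_⟩
  have hmem := hint.collectedBasis_mem (fun i => (stdOrthonormalBasis ℝ
    (Module.End.eigenspace X i.2 ⊓ Module.End.eigenspace Y i.1 : Submodule ℝ E)).toBasis)
    (f.symm j)
  rw [Submodule.mem_inf, Module.End.mem_eigenspace_iff, Module.End.mem_eigenspace_iff] at hmem
  have hbv : b (f.symm j) = _ := congrFun (hint.collectedBasis_coe _) (f.symm j)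
  simpa [hbv] using hmem

lemma exists_angle_of_sq_add_sq {x y : ℝ} (h : x ^ 2 + y ^ 2 = x) :
    ∃ t : ℝ, 0 ≤ t ∧ t < Real.pi ∧ x = Real.cos t ^ 2 ∧ y = Real.sin t * Real.cos t := by
  by_cases hx : x = 0
  · refine ⟨Real.pi / 2, by positivity, by linarith [Real.pi_pos], by simp [hx], ?_⟩
    subst hx
    simpa using h
  · have hxpos : 0 < x := lt_of_le_of_ne (by nlinarith [sq_nonneg x, sq_nonneg y]) (Ne.symm hx)
    have key : ∀ s : ℝ, s = Real.arctan (y / x) → x = Real.cos s ^ 2 ∧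
        y = Real.sin s * Real.cos s := by
      rintro s rfl
      have h1 : x = Real.cos (Real.arctan (y / x)) ^ 2 := by
        rw [Real.cos_sq_arctan]
        field_simp
        nlinarith
      refine ⟨h1, ?_⟩
      have h2 := Real.tan_mul_cos (Real.cos_arctan_pos (y / x)).ne'
      rw [Real.tan_arctan] at h2
      rw [← h2, mul_assoc, ← sq, ← h1]
      field_simp
    obtain ⟨h1, h2⟩ := key _ rfl
    have h3 := Real.neg_pi_div_two_lt_arctan (y / x)
    have h4 := Real.arctan_lt_pi_div_two (y / x)
    by_cases hs : 0 ≤ Real.arctan (y / x)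
    · exact ⟨_, hs, by linarith [Real.pi_pos], h1, h2⟩
    -- `cos²` and `sin * cos` have period `π`, so a negative angle is shifted into `[0, π)`.
    · refine ⟨Real.arctan (y / x) + Real.pi, by linarith [Real.pi_pos], by linarith, ?_, ?_⟩
      · rw [Real.cos_add_pi, neg_sq]; exact h1
      · rw [Real.cos_add_pi, Real.sin_add_pi, neg_mul_neg]; exact h2

/-- Each `e_j` is rotated in the plane of `e_j` and `J e_j`, and these planes are mutually
orthogonal because `V` is Lagrangian. -/
lemma orthonormal_rot {V : Submodule ℝ (Space k k)} (hV : IsLagrangian V)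
    {e : Fin k → Space k k} (he : Orthonormal ℝ e) (heV : ∀ j, e j ∈ V) (θ : Fin k → ℝ) :
    Orthonormal ℝ (fun j => rot (θ j) (e j)) := by
  rw [orthonormal_iff_ite] at he ⊢
  intro i j
  have h1 := hV.inner_J_eq_zero (heV i) (heV j)
  have h2 : ⟪J k (e i), e j⟫ = 0 := by
    rw [inner_J_right, neg_eq_zero] at h1; exact h1
  simp only [rot_apply, inner_add_left, inner_add_right, inner_smul_left, inner_smul_right,
    inner_J_J, h1, h2, he i j]
  split_ifs with hij
  · subst hij
    simp
    nlinarith [Real.sin_sq_add_cos_sq (θ i)]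
  · simp

/-- With `P`, `Q` the projections onto `V`, `W`, the operators `PQ` and `-PJQ` on `V` are symmetric
and commute. At a joint eigenvector `e` they give `Q e = x e + y J e`. Idempotence of `Q` forces `x²
+ y² = x`, hence `x = cos² θ`, `y = sin θ cos θ`, and then `Q` fixes `e^{θJ} e`. -/
lemma exists_isAngleFrame {V W : Submodule ℝ (Space k k)} (hV : IsLagrangian V)
    (hW : IsLagrangian W) : ∃ e θ, IsAngleFrame V W e θ := by
  set P := V.starProjection
  set Q := W.starProjection
  have PP : ∀ u ∈ V, P u = u := fun u hu => Submodule.starProjection_eq_self_iff.2 hu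
  have QQ : ∀ u ∈ W, Q u = u := fun u hu => Submodule.starProjection_eq_self_iff.2 hu
  have Pm : ∀ u, P u ∈ V := fun u => Submodule.starProjection_apply_mem V u
  have Qm : ∀ u, Q u ∈ W := fun u => Submodule.starProjection_apply_mem W u
  have PJ : ∀ u, P (J k u) = J k u - J k (P u) := hV.starProjection_J
  have QJ : ∀ u, Q (J k u) = J k u - J k (Q u) := hW.starProjection_J
  have Ps : ∀ u v, ⟪P u, v⟫ = ⟪u, P v⟫ := Submodule.starProjection_isSymmetric V
  have Qs : ∀ u v, ⟪Q u, v⟫ = ⟪u, Q v⟫ := Submodule.starProjection_isSymmetric W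
  let X : V →ₗ[ℝ] V := (P.toLinearMap ∘ₗ Q.toLinearMap).restrict (fun u _ => Pm _)
  let Y : V →ₗ[ℝ] V := (-(P.toLinearMap ∘ₗ J k ∘ₗ Q.toLinearMap)).restrict
    (fun u _ => neg_mem (Pm _))
  have Xc : ∀ u : V, (X u : Space k k) = P (Q u) := fun u => rfl
  have Yc : ∀ u : V, (Y u : Space k k) = -P (J k (Q u)) := fun u => rfl
  have Yc' : ∀ u : V, (Y u : Space k k) = P (Q (J k u)) := by
    intro u
    rw [Yc, QJ, map_sub, PJ u, PP u u.2, sub_self, zero_sub]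
  have hX : X.IsSymmetric := by
    intro u v
    rw [Submodule.coe_inner, Submodule.coe_inner, Xc, Xc, Ps, PP v v.2, Qs, ← Ps, PP u u.2]
  have hY : Y.IsSymmetric := by
    intro u v
    rw [Submodule.coe_inner, Submodule.coe_inner, Yc, Yc', inner_neg_left, Ps, PP v v.2,
      ← Ps, PP u u.2, ← Qs, inner_J_right]
  have hXY : Commute X Y := by
    ext1 u
    apply Subtype.ext
    change (X (Y u) : Space k k) = (Y (X u) : Space k k)
    rw [Yc', Xc, Xc, Yc]
    have h1 : P (J k (Q u)) = J k (Q u) - J k (P (Q u)) := PJ _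
    have h2 : Q (J k (Q u)) = 0 := by rw [QJ, QQ _ (Qm _), sub_self]
    rw [h1, map_neg, map_sub, h2, zero_sub, neg_neg]
  obtain ⟨e, x, y, hxy⟩ := exists_orthonormalBasis_of_commute hX hY hXY hV.finrank_eq
  have hQ : ∀ j, Q (e j) = x j • (e j : Space k k) + y j • J k (e j) := by
    intro j
    have h1 : P (Q (e j)) = x j • (e j : Space k k) := by
      rw [← Xc, (hxy j).1]; rfl
    have h2 : -P (J k (Q (e j))) = y j • (e j : Space k k) := by
      rw [← Yc, (hxy j).2]; rfl
    rw [PJ, h1] at h2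
    have h3 := congrArg (J k) h2
    simp only [map_neg, map_sub, J_J, map_smul] at h3
    rw [← h3]
    module
  have hne : ∀ j, (e j : Space k k) ≠ 0 := fun j h =>
    e.orthonormal.ne_zero j (Subtype.ext h)
  have hrel : ∀ j, x j ^ 2 + y j ^ 2 = x j := by
    intro j
    have h1 : Q (Q (e j)) = Q (e j) := QQ _ (Qm _)
    have h2 : Q (Q (e j)) = (x j ^ 2 + y j ^ 2) • (e j : Space k k) + y j • J k (e j) := by
      conv_lhs => rw [hQ j]
      rw [map_add, map_smul, map_smul, QJ, hQ j]
      simp only [map_add, map_smul, J_J]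
      module
    rw [h1, hQ j, add_left_inj] at h2
    exact (smul_left_injective ℝ (hne j) h2).symm
  choose θ h0 hpi hx hy using fun j => exists_angle_of_sq_add_sq (hrel j)
  have horth : Orthonormal ℝ (fun j => (e j : Space k k)) :=
    e.orthonormal.comp_linearIsometry V.subtypeₗᵢ
  refine ⟨fun j => e j, θ, horth, ?_, h0, hpi, ?_⟩
  · have h1 := e.toBasis.span_eq
    have h2 := congrArg (Submodule.map V.subtype) h1
    rw [Submodule.map_span, ← range_comp, Submodule.map_top, Submodule.range_subtype] at h2
    simpa [Function.comp_def] using h2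
  · refine Submodule.eq_of_le_of_finrank_eq ?_ ?_
    · rw [Submodule.span_le]
      rintro _ ⟨j, rfl⟩
      refine Submodule.starProjection_eq_self_iff.1 ?_
      change Q _ = _
      simp only [rot_apply, map_add, map_smul, QJ, hQ j, J_J, hx, hy]
      have h := Real.sin_sq_add_cos_sq (θ j)
      have h1 : Real.cos (θ j) ^ 2 = 1 - Real.sin (θ j) ^ 2 := by linarith
      match_scalars
      · linear_combination Real.cos (θ j) * h
      · ring
    · rw [hW.finrank_eq, finrank_span_eq_card
        (orthonormal_rot hV horth (fun j => (e j).2) θ).linearIndependent, Fintype.card_fin]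

/-! ### Frames, and the determinant in terms of the angles -/

lemma IsFrame.mem {l r : ℕ} {v : Fin r → Space k l} {V : Submodule ℝ (Space k l)}
    (h : IsFrame v V) (j : Fin r) : v j ∈ V :=
  h.2 ▸ Submodule.subset_span (mem_range_self j)

lemma IsFrame.exists_basis {l r : ℕ} {v : Fin r → Space k l} {V : Submodule ℝ (Space k l)}
    (h : IsFrame v V) : ∃ b : Module.Basis (Fin r) ℝ V, ∀ j, (b j : Space k l) = v j := by
  obtain ⟨h, rfl⟩ := h
  exact ⟨Module.Basis.span h, fun j => by simp⟩

lemma IsFrame.map_rot {r : ℕ} {w : Fin r → Space k k} {W : Submodule ℝ (Space k k)}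
    (h : IsFrame w W) (t : ℝ) : IsFrame (fun j => rot (-t) (w j)) (rotated t W) := by
  refine ⟨h.1.map' (rot (-t)) (LinearMap.ker_eq_bot.2 (rot_injective _)), ?_⟩
  rw [rotated, ← h.2, Submodule.map_span, ← range_comp]
  rfl

lemma IsFrame.det_ne_zero {l : ℕ} {v : Fin k → Space k l} {w : Fin l → Space k l}
    {V W : Submodule ℝ (Space k l)} (hv : IsFrame v V) (hw : IsFrame w W) (h : V ⊓ W = ⊥) :
    (frameMatrix v w).det ≠ 0 := by
  have hli : LinearIndependent ℝ (Sum.elim v w) := by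
    refine hv.1.sum_type hw.1 ?_
    rw [hv.2, hw.2, disjoint_iff, h]
  have hcol : LinearIndependent ℝ (frameMatrix v w).col :=
    hli.map' (WithLp.linearEquiv 2 ℝ (Fin k ⊕ Fin l → ℝ)).toLinearMap
      (LinearEquiv.ker _)
  rw [Matrix.linearIndependent_cols_iff_isUnit, Matrix.isUnit_iff_isUnit_det] at hcol
  exact hcol.ne_zero

/-- The determinant `det [v | e^{-tJ} w]`. -/
def rotDet (v w : Fin k → Space k k) (t : ℝ) : ℝ :=
  (frameMatrix v fun j => rot (-t) (w j)).det

lemma rotDet_zero (v w : Fin k → Space k k) : rotDet v w 0 = (frameMatrix v w).det := by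
  simp [rotDet, rot_zero]

lemma neg_one_pow_card_filter (p : Fin k → Prop) [DecidablePred p] :
    (-1 : ℝ) ^ (Finset.univ.filter p).card = ∏ j, if p j then -1 else 1 := by
  rw [Finset.prod_ite]
  simp

lemma sin_sub_eq_zero_iff {x t : ℝ} (hx0 : 0 ≤ x) (hx : x < Real.pi) (ht0 : 0 ≤ t)
    (ht : t < Real.pi) : Real.sin (x - t) = 0 ↔ x = t := by
  rw [Real.sin_eq_zero_iff_of_lt_of_lt (by linarith) (by linarith), sub_eq_zero]

namespace IsAngleFrame

variable {V W : Submodule ℝ (Space k k)} {e : Fin k → Space k k} {θ : Fin k → ℝ}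

lemma isFrame_left (h : IsAngleFrame V W e θ) : IsFrame e V :=
  ⟨h.orthonormal.linearIndependent, h.span_eq⟩

lemma isFrame_right (h : IsAngleFrame V W e θ) (hV : IsLagrangian V) :
    IsFrame (fun j => rot (θ j) (e j)) W :=
  ⟨(orthonormal_rot hV h.orthonormal h.isFrame_left.mem θ).linearIndependent, h.span_rot_eq⟩

lemma inner_J (h : IsAngleFrame V W e θ) (i j : Fin k) :
    ⟪J k (e i), J k (e j)⟫ = if i = j then 1 else 0 := by
  rw [inner_J_J]
  exact orthonormal_iff_ite.1 h.orthonormal i j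

lemma inf_rotated_eq (h : IsAngleFrame V W e θ) (hV : IsLagrangian V) {t : ℝ} (ht0 : 0 ≤ t)
    (ht : t < Real.pi) : V ⊓ rotated t W = Submodule.span ℝ (range fun j : {j // θ j = t} => e j)
    := by
  refine le_antisymm ?_ ?_
  · rintro _ ⟨hx, y, hy, rfl⟩
    rw [← h.span_rot_eq, SetLike.mem_coe, Submodule.mem_span_range_iff_exists_fun] at hy
    obtain ⟨c, rfl⟩ := hy
    simp only [map_sum, map_smul, rot_rot, SetLike.mem_coe] at hx ⊢
    -- Pairing with `J e_i`, which is orthogonal to `V`, isolates the sine part of the `i`-th term.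
    have hc : ∀ i, c i * Real.sin (-t + θ i) = 0 := by
      intro i
      have h1 := hV.inner_J_eq_zero hx (h.isFrame_left.mem i)
      simp only [sum_inner, inner_smul_left, rot_apply, inner_add_left,
        hV.inner_J_eq_zero (h.isFrame_left.mem _) (h.isFrame_left.mem i), h.inner_J] at h1
      simpa using h1
    refine Submodule.sum_mem _ fun j _ => ?_
    rcases mul_eq_zero.1 (hc j) with hj | hj
    · simp [hj]
    · rw [neg_add_eq_sub, sin_sub_eq_zero_iff (h.nonneg j) (h.lt_pi j) ht0 ht] at hj
      rw [hj, neg_add_cancel, rot_zero]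
      exact Submodule.smul_mem _ _ (Submodule.subset_span ⟨⟨j, hj⟩, rfl⟩)
  · rw [Submodule.span_le]
    rintro _ ⟨⟨j, rfl⟩, rfl⟩
    exact ⟨h.isFrame_left.mem j, _, (h.isFrame_right hV).mem j, rot_neg_rot _ _⟩

lemma finrank_inf_rotated (h : IsAngleFrame V W e θ) (hV : IsLagrangian V) {t : ℝ}
    (ht0 : 0 ≤ t) (ht : t < Real.pi) : Module.finrank ℝ ↥(V ⊓ rotated t W) =
      (Finset.univ.filter fun j => θ j = t).card := by
  rw [h.inf_rotated_eq hV ht0 ht, ← Fintype.card_subtype]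
  exact finrank_span_eq_card (h.orthonormal.linearIndependent.comp _ Subtype.val_injective)

lemma inf_rotated_eq_bot_iff (h : IsAngleFrame V W e θ) (hV : IsLagrangian V) {t : ℝ}
    (ht0 : 0 ≤ t) (ht : t < Real.pi) : V ⊓ rotated t W = ⊥ ↔ ∀ j, θ j ≠ t := by
  rw [← Submodule.finrank_eq_zero, h.finrank_inf_rotated hV ht0 ht, Finset.card_eq_zero,
    Finset.filter_eq_empty_iff]
  simp

lemma angleCount_eq (h : IsAngleFrame V W e θ) (hV : IsLagrangian V) {ε : ℝ}
    (hε : ε ≤ Real.pi) : angleCount V W ε =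
      (Finset.univ.filter fun j => 0 < θ j ∧ θ j < ε).card := by
  classical
  set s : Finset ℝ := (Finset.univ.filter fun j => 0 < θ j ∧ θ j < ε).image θ
  have hs : ∀ t ∈ Ioo 0 ε, Module.finrank ℝ ↥(V ⊓ rotated t W) ≠ 0 ↔ t ∈ s := by
    intro t ht
    rw [h.finrank_inf_rotated hV ht.1.le (ht.2.trans_le hε), Finset.card_ne_zero]
    simp only [s, Finset.mem_image, Finset.mem_filter, Finset.mem_univ, true_and,
      Finset.Nonempty]
    constructor
    · rintro ⟨j, rfl⟩; exact ⟨j, ht, rfl⟩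
    · rintro ⟨j, -, rfl⟩; exact ⟨j, rfl⟩
  have hs' : ∀ t ∈ s, t ∈ Ioo 0 ε := by
    intro t ht
    simp only [s, Finset.mem_image, Finset.mem_filter] at ht
    obtain ⟨j, hj, rfl⟩ := ht
    exact hj.2
  rw [angleCount, finsum_mem_eq_sum_of_inter_support_eq (t := s)]
  · rw [Finset.card_eq_sum_card_image θ]
    refine Finset.sum_congr rfl fun t ht => ?_
    rw [h.finrank_inf_rotated hV (hs' t ht).1.le ((hs' t ht).2.trans_le hε), Finset.filter_filter]
    congr 1
    ext j
    simp only [Finset.mem_filter, Finset.mem_univ, true_and]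
    constructor
    · rintro rfl; exact ⟨hs' _ ht, rfl⟩
    · exact fun hj => hj.2
  · ext t
    simp only [mem_inter_iff, Function.mem_support, Finset.mem_coe]
    constructor
    · rintro ⟨h1, h2⟩; exact ⟨(hs t h1).1 h2, h2⟩
    · rintro ⟨h1, h2⟩; exact ⟨hs' t h1, h2⟩

lemma exists_notMem (θ : Fin k → ℝ) : ∃ t : ℝ, 0 < t ∧ t < Real.pi ∧ ∀ j, θ j ≠ t := by
  obtain ⟨t, ht, h⟩ := (Ioo_infinite Real.pi_pos).exists_notMem_finite (finite_range θ)
  exact ⟨t, ht.1, ht.2, fun j hj => h ⟨j, hj⟩⟩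

/-- Expanding in the basis `e_j`, `J e_j` makes the matrix block triangular, with diagonal blocks
`G` and `diag (sin (θ_j - t)) H`, where `G`, `H` are the changes of frame. -/
lemma exists_rotDet_eq (h : IsAngleFrame V W e θ) (hV : IsLagrangian V)
    {v w : Fin k → Space k k} (hv : IsFrame v V) (hw : IsFrame w W) :
    ∃ K : ℝ, K ≠ 0 ∧ ∀ t, rotDet v w t = K * ∏ j, Real.sin (θ j - t) := by
  obtain ⟨be, hbe⟩ := h.isFrame_left.exists_basis
  obtain ⟨bf, hbf⟩ := (h.isFrame_right hV).exists_basis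
  obtain ⟨bv, hbv⟩ := hv.exists_basis
  obtain ⟨bw, hbw⟩ := hw.exists_basis
  let G : Matrix (Fin k) (Fin k) ℝ := Matrix.of fun j c => be.repr (bv c) j
  let H : Matrix (Fin k) (Fin k) ℝ := Matrix.of fun j c => bf.repr (bw c) j
  have hG : ∀ c, v c = ∑ j, G j c • e j := by
    intro c
    have := congrArg V.subtype (be.sum_repr (bv c))
    simp only [map_sum, map_smul, Submodule.subtype_apply, hbe, hbv] at this
    exact this.symm
  have hH : ∀ c, w c = ∑ j, H j c • rot (θ j) (e j) := by
    intro c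
    have := congrArg W.subtype (bf.sum_repr (bw c))
    simp only [map_sum, map_smul, Submodule.subtype_apply, hbf, hbw] at this
    exact this.symm
  have hfac : ∀ t, frameMatrix v (fun j => rot (-t) (w j)) =
      frameMatrix e (fun j => J k (e j)) * Matrix.fromBlocks G
        (Matrix.diagonal (fun j => Real.cos (θ j - t)) * H) 0
        (Matrix.diagonal (fun j => Real.sin (θ j - t)) * H) := by
    intro t
    ext r c
    rcases c with c | c
    · simp [frameMatrix, Matrix.mul_apply, hG, mul_comm]
    · rw [Matrix.mul_apply]
      simp only [frameMatrix, hH, map_sum, map_smul, rot_rot,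
        Fintype.sum_sum_type, neg_add_eq_sub, Matrix.of_apply, Sum.elim_inl, Sum.elim_inr,
        Matrix.fromBlocks_apply₁₂, Matrix.fromBlocks_apply₂₂, Matrix.diagonal_mul,
        ← Finset.sum_add_distrib]
      simp [rot_apply]
      exact Finset.sum_congr rfl fun j _ => by ring
  have hdet : ∀ t, rotDet v w t = (frameMatrix e (fun j => J k (e j))).det * G.det * H.det *
      ∏ j, Real.sin (θ j - t) := by
    intro t
    rw [rotDet, hfac, Matrix.det_mul, Matrix.det_fromBlocks_zero₂₁, Matrix.det_mul,
      Matrix.det_diagonal]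
    ring
  refine ⟨_, ?_, hdet⟩
  -- The constant is nonzero because the determinant is nonzero at any level that is not an angle.
  obtain ⟨t, ht0, ht, htθ⟩ := exists_notMem θ
  have h1 : rotDet v w t ≠ 0 := hv.det_ne_zero (hw.map_rot t)
    ((h.inf_rotated_eq_bot_iff hV ht0.le ht).2 htθ)
  rw [hdet] at h1
  exact left_ne_zero_of_mul h1

end IsAngleFrame

/-! ### Transversality and the sign of the determinant -/

lemma inf_eq_bot_of_transversal {V W : Submodule ℝ (Space k k)} (hV : IsLagrangian V)
    (hW : IsLagrangian W) (h : Transversal V W) : V ⊓ W = ⊥ := by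
  have h1 := Submodule.finrank_sup_add_finrank_inf_eq V W
  have h2 : Module.finrank ℝ ↥(V ⊔ W) = k + k := by
    rw [show V ⊔ W = ⊤ from h, finrank_top]; simp
  rw [hV.finrank_eq, hW.finrank_eq, h2] at h1
  rw [← Submodule.finrank_eq_zero (R := ℝ)]
  omega

lemma exists_rotDet_ne_zero {V W : Submodule ℝ (Space k k)} (hV : IsLagrangian V)
    (hW : IsLagrangian W) {v w : Fin k → Space k k} (hv : IsFrame v V) (hw : IsFrame w W) :
    ∃ t : ℝ, 0 < t ∧ t < Real.pi ∧ rotDet v w t ≠ 0 := by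
  obtain ⟨e, θ, h⟩ := exists_isAngleFrame hV hW
  obtain ⟨t, ht0, ht, htθ⟩ := IsAngleFrame.exists_notMem θ
  exact ⟨t, ht0, ht, hv.det_ne_zero (hw.map_rot t)
    ((h.inf_rotated_eq_bot_iff hV ht0.le ht).2 htθ)⟩

lemma rotDet_ne_zero_iff {V W : Submodule ℝ (Space k k)} (hV : IsLagrangian V)
    (hW : IsLagrangian W) {v w : Fin k → Space k k} (hv : IsFrame v V) (hw : IsFrame w W)
    {t : ℝ} (ht0 : 0 ≤ t) (ht : t < Real.pi) :
    rotDet v w t ≠ 0 ↔ V ⊓ rotated t W = ⊥ := by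
  obtain ⟨e, θ, h⟩ := exists_isAngleFrame hV hW
  obtain ⟨K, hK, hdet⟩ := h.exists_rotDet_eq hV hv hw
  rw [h.inf_rotated_eq_bot_iff hV ht0 ht, hdet, mul_ne_zero_iff, Finset.prod_ne_zero_iff]
  simp [hK, sin_sub_eq_zero_iff (h.nonneg _) (h.lt_pi _) ht0 ht]

/-- The sign of `det [v | e^{-εJ} w]`, corrected by the parity of the number of angles in `(0, ε)`,
does not depend on `ε`. -/
lemma exists_sign {V W : Submodule ℝ (Space k k)} (hV : IsLagrangian V)
    (hW : IsLagrangian W) {v w : Fin k → Space k k} (hv : IsFrame v V) (hw : IsFrame w W) :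
    ∃ κ : ℝ, (∀ ε, 0 < ε → ε < Real.pi → V ⊓ rotated ε W = ⊥ →
        0 < κ * rotDet v w ε * (-1) ^ angleCount V W ε) ∧
      (Transversal V W → 0 < κ * (frameMatrix v w).det) := by
  obtain ⟨e, θ, h⟩ := exists_isAngleFrame hV hW
  obtain ⟨K, hK, hdet⟩ := h.exists_rotDet_eq hV hv hw
  have hK2 : 0 < K * K := mul_self_pos.2 hK
  -- An angle `0` contributes `sin (-ε) < 0` at every level but is not counted in the open interval
  -- `(0, ε)`; `κ` absorbs its sign.
  refine ⟨K * ∏ j, (if θ j = 0 then -1 else 1), ?_, ?_⟩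
  · intro ε hε0 hε hVW
    rw [h.inf_rotated_eq_bot_iff hV hε0.le hε] at hVW
    rw [h.angleCount_eq hV hε.le, neg_one_pow_card_filter, hdet]
    have : 0 < ∏ j, (if θ j = 0 then (-1 : ℝ) else 1) * Real.sin (θ j - ε) *
        (if 0 < θ j ∧ θ j < ε then -1 else 1) := by
      refine Finset.prod_pos fun j _ => ?_
      have h1 := h.lt_pi j
      rcases (h.nonneg j).eq_or_lt with h0 | h0
      · rw [← h0]
        simp [Real.sin_pos_of_pos_of_lt_pi hε0 hε]
      · rw [if_neg h0.ne', one_mul]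
        rcases (hVW j).lt_or_gt with hj | hj
        · rw [if_pos ⟨h0, hj⟩]
          have := Real.sin_neg_of_neg_of_neg_pi_lt (x := θ j - ε) (by linarith) (by linarith)
          linarith
        · rw [if_neg (fun h' => hj.not_gt h'.2), mul_one]
          exact Real.sin_pos_of_pos_of_lt_pi (by linarith) (by linarith)
    rw [Finset.prod_mul_distrib, Finset.prod_mul_distrib] at this
    have h2 := mul_pos hK2 this
    linarith
  · intro hT
    have h0 := inf_eq_bot_of_transversal hV hW hT
    rw [← rotated_zero W, h.inf_rotated_eq_bot_iff hV le_rfl Real.pi_pos] at h0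
    rw [← rotDet_zero, hdet]
    have : 0 < ∏ j, Real.sin (θ j - 0) := by
      refine Finset.prod_pos fun j _ => ?_
      rw [sub_zero]
      exact Real.sin_pos_of_pos_of_lt_pi (lt_of_le_of_ne (h.nonneg j) (h0 j).symm) (h.lt_pi j)
    have h2 : ∏ j, (if θ j = 0 then (-1 : ℝ) else 1) = 1 :=
      Finset.prod_eq_one fun j _ => if_neg (h0 j)
    rw [h2, mul_one, ← mul_assoc]
    exact mul_pos hK2 this

/-! ### Continuous frames -/

lemma continuous_starProjection :
    Continuous fun L : Lag k => L.toSubspace.starProjection :=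
  Isometry.continuous (f := fun L : Lag k => L.toSubspace.starProjection)
    (Isometry.of_dist_eq fun _ _ => rfl)

lemma exists_isFrame {V : Submodule ℝ (Space k k)} (hV : IsLagrangian V) :
    ∃ v : Fin k → Space k k, IsFrame v V :=
  let ⟨e, _, h⟩ := exists_isAngleFrame hV hV
  ⟨e, h.isFrame_left⟩

lemma eq_zero_of_starProjection_eq_zero {V W : Submodule ℝ (Space k k)}
    (h : ‖V.starProjection - W.starProjection‖ < 1) {u : Space k k} (hu : u ∈ V)
    (hu0 : W.starProjection u = 0) : u = 0 := by
  by_contra hne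
  have h1 := (V.starProjection - W.starProjection).le_opNorm u
  rw [sub_apply, hu0, sub_zero,
    Submodule.starProjection_eq_self_iff.2 hu] at h1
  have h2 := norm_pos_iff.2 hne
  nlinarith

/-- A continuous path of Lagrangian subspaces over a compact interval has a continuous frame. -/
lemma exists_continuous_frame {a b : ℝ} (hab : a ≤ b) {L : Icc a b → Lag k}
    (hL : Continuous L) : ∃ v : Icc a b → Fin k → Space k k,
      Continuous v ∧ ∀ s, IsFrame (v s) (L s).toSubspace := by
  let P : Icc a b → Space k k →L[ℝ] Space k k := fun s => (L s).toSubspace.starProjection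
  have hP : Continuous P := continuous_starProjection.comp hL
  -- On each piece the projections lie within `1/2` of a fixed one, hence within distance `1` of
  -- each other, so projecting between two such subspaces is injective.
  obtain ⟨t, ht0, htm, ⟨m, hm⟩, htc⟩ := exists_monotone_Icc_subset_open_cover_Icc hab
    (c := fun i : Icc a b => {s | ‖P s - P i‖ < 1 / 2})
    (fun i => isOpen_lt (by fun_prop) continuous_const)
    (fun s _ => mem_iUnion.2 ⟨s, by simp⟩)
  have hclose : ∀ n, ∀ r ∈ Icc (t n) (t (n + 1)), ∀ s ∈ Icc (t n) (t (n + 1)),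
      ‖P r - P s‖ < 1 := by
    intro n r hr s hs
    obtain ⟨i, hi⟩ := htc n
    have h1 : ‖P r - P i‖ < 1 / 2 := hi hr
    have h2 : ‖P s - P i‖ < 1 / 2 := hi hs
    calc ‖P r - P s‖ = ‖(P r - P i) - (P s - P i)‖ := by rw [sub_sub_sub_cancel_right]
      _ ≤ ‖P r - P i‖ + ‖P s - P i‖ := norm_sub_le _ _
      _ < 1 := by linarith
  -- `A n s` transports `L (t 0)` to `L (min s (t n))` by successive projections along the
  -- subdivision; the `min` stops the transport at `s` and keeps it continuous in `s`.
  let A : ℕ → Icc a b → Space k k →L[ℝ] Space k k := fun n => Nat.rec (fun _ => P (t 0))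
    (fun i f s => (P (min s (t (i + 1)))).comp (f s)) n
  have hA : ∀ n, Continuous (A n) := by
    intro n
    induction n with
    | zero => exact continuous_const
    | succ n ih => exact (hP.comp (continuous_id.min continuous_const)).clm_comp ih
  have hAinj : ∀ n s, ∀ u ∈ (L (t 0)).toSubspace, A n s u ∈ (L (min s (t n))).toSubspace ∧
      (A n s u = 0 → u = 0) := by
    intro n
    induction n with
    | zero =>
      intro s u hu
      have h1 : A 0 s u = u := Submodule.starProjection_eq_self_iff.2 hu
      have h2 : min s (t 0) = t 0 := min_eq_right (Subtype.coe_le_coe.1 (ht0.le.trans s.2.1))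
      rw [h1, h2]
      exact ⟨hu, id⟩
    | succ n ih =>
      intro s u hu
      obtain ⟨h1, h2⟩ := ih s u hu
      refine ⟨Submodule.starProjection_apply_mem _ _, fun h => h2 ?_⟩
      refine eq_zero_of_starProjection_eq_zero ?_ h1 h
      change ‖P (min s (t n)) - P (min s (t (n + 1)))‖ < 1
      have h3 : t n ≤ t (n + 1) := htm n.le_succ
      rcases le_total s (t n) with hs | hs
      · rw [min_eq_left hs, min_eq_left (hs.trans h3)]
        simp
      · rw [min_eq_right hs]
        exact hclose n _ ⟨le_rfl, h3⟩ _ ⟨le_min hs h3, min_le_right _ _⟩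
  obtain ⟨v, hv⟩ := exists_isFrame (L (t 0)).2
  refine ⟨fun s j => A m s (v j), ?_, fun s => ?_⟩
  · exact continuous_pi fun j => (hA m).clm_apply continuous_const
  · have hs : min s (t m) = s := min_eq_left (Subtype.coe_le_coe.1 (s.2.2.trans (hm m le_rfl).ge))
    have hmem : ∀ j, A m s (v j) ∈ (L s).toSubspace := by
      intro j
      have := (hAinj m s (v j) (hv.mem j)).1
      rwa [hs] at this
    have hli : LinearIndependent ℝ fun j => A m s (v j) := by
      refine LinearIndependent.map (f := (A m s).toLinearMap) hv.1 ?_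
      rw [Submodule.disjoint_def]
      intro u hu h0
      rw [hv.2] at hu
      exact (hAinj m s u hu).2 h0
    refine ⟨hli, Submodule.eq_of_le_of_finrank_eq ?_ ?_⟩
    · rw [Submodule.span_le]
      rintro _ ⟨j, rfl⟩
      exact hmem j
    · rw [finrank_span_eq_card hli, Fintype.card_fin]
      exact ((L s).2.finrank_eq).symm

/-! ### Semicontinuity of the signature -/

section Signature

open QuadraticMap

/-- A maximal positive definite subspace stays positive definite for nearby forms, by compactness of
its unit sphere. -/
lemma eventually_sigPos_le {T : Type*} [TopologicalSpace T] {q : T → QuadraticForm ℝ (Fin k → ℝ)}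
    (hq : Continuous fun p : T × (Fin k → ℝ) => q p.1 p.2) (s₀ : T) :
    ∀ᶠ s in 𝓝 s₀, sigPos (q s₀) ≤ sigPos (q s) := by
  obtain ⟨F, hF, hpos⟩ := exists_finrank_eq_sigPos_and_posDef (q s₀)
  have hK : IsCompact (Metric.sphere (0 : Fin k → ℝ) 1 ∩ F) :=
    (isCompact_sphere _ _).inter_right F.closed_of_finiteDimensional
  have hev := hK.eventually_forall_of_forall_eventually (x₀ := s₀)
    (P := fun s x => 0 < q s x) fun x hx => by
      have hx0 : x ≠ 0 := by
        rintro rfl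
        simpa using hx.1
      exact hq.continuousAt.eventually (lt_mem_nhds
        (hpos ⟨x, hx.2⟩ (fun h => hx0 (congrArg Subtype.val h))))
  filter_upwards [hev] with s hs
  rw [← hF]
  refine le_sigPos_of_posDef _ ?_
  rintro ⟨x, hx⟩ hne
  have hx0 : x ≠ 0 := fun h => hne (Subtype.ext h)
  have hn : 0 < ‖x‖ := norm_pos_iff.2 hx0
  have h1 := hs (‖x‖⁻¹ • x) ⟨by simp [norm_smul, hn.ne'], F.smul_mem _ hx⟩
  rw [QuadraticMap.map_smul, smul_eq_mul] at h1
  exact pos_of_mul_pos_right h1 (by positivity)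

lemma eventually_sigNeg_le {T : Type*} [TopologicalSpace T] {q : T → QuadraticForm ℝ (Fin k → ℝ)}
    (hq : Continuous fun p : T × (Fin k → ℝ) => q p.1 p.2) (s₀ : T) :
    ∀ᶠ s in 𝓝 s₀, sigNeg (q s₀) ≤ sigNeg (q s) :=
  eventually_sigPos_le (q := fun s => -q s) hq.neg s₀

/-- The signature is locally constant at a nondegenerate form. -/
lemma eventually_sigNeg_eq {T : Type*} [TopologicalSpace T] {q : T → QuadraticForm ℝ (Fin k → ℝ)}
    (hq : Continuous fun p : T × (Fin k → ℝ) => q p.1 p.2) {s₀ : T}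
    (h₀ : k ≤ sigPos (q s₀) + sigNeg (q s₀)) :
    ∀ᶠ s in 𝓝 s₀, sigNeg (q s) = sigNeg (q s₀) := by
  -- Neither index can drop nearby, and their sum is at most `k`, which is already attained at `s₀`.
  filter_upwards [eventually_sigPos_le hq s₀, eventually_sigNeg_le hq s₀] with s h1 h2
  have h3 := QuadraticForm.sigPos_add_sigNeg_add_radical (Q := q s)
  rw [Module.finrank_fin_fun] at h3
  omega

end Signature

/-! ### Counting angles between two levels by a quadratic form -/

/-- The component orthogonal to `V` of `e^{-tJ} ∑ x_i w_i`, as a linear function of `x`. -/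
def transverseMap (V : Submodule ℝ (Space k k)) (w : Fin k → Space k k) (t : ℝ) :
    (Fin k → ℝ) →ₗ[ℝ] Space k k :=
  (LinearMap.id - V.starProjection.toLinearMap) ∘ₗ rot (-t) ∘ₗ Fintype.linearCombination ℝ w

lemma transverseMap_apply (V : Submodule ℝ (Space k k)) (w : Fin k → Space k k) (t : ℝ)
    (x : Fin k → ℝ) : transverseMap V w t x =
      rot (-t) (∑ i, x i • w i) - V.starProjection (rot (-t) (∑ i, x i • w i)) := by
  rw [← Fintype.linearCombination_apply]
  rfl

/-- The quadratic form on (coordinates of) `W` whose negative index is the number of angles of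
`V`, `W` between `α` and `β`. -/
def angleForm (V : Submodule ℝ (Space k k)) (w : Fin k → Space k k) (α β : ℝ) :
    QuadraticForm ℝ (Fin k → ℝ) :=
  LinearMap.BilinMap.toQuadraticMap
    ((innerₗ (Space k k)).compl₁₂ (transverseMap V w α) (transverseMap V w β))

lemma angleForm_apply (V : Submodule ℝ (Space k k)) (w : Fin k → Space k k) (α β : ℝ)
    (x : Fin k → ℝ) :
    angleForm V w α β x = ⟪transverseMap V w α x, transverseMap V w β x⟫ := by
  simp [angleForm]

namespace IsAngleFrame

variable {V W : Submodule ℝ (Space k k)} {e : Fin k → Space k k} {θ : Fin k → ℝ}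

/-- The component of `e^{-tJ} e^{θ_j J} e_j` orthogonal to `V` is `sin (θ_j - t) J e_j`, so one
orthonormal family diagonalises the form for all levels. -/
lemma equivalent_angleForm (h : IsAngleFrame V W e θ) (hV : IsLagrangian V)
    {w : Fin k → Space k k} (hw : IsFrame w W) (α β : ℝ) :
    QuadraticMap.Equivalent (angleForm V w α β) (QuadraticMap.weightedSumSquares ℝ
      fun j => Real.sin (θ j - α) * Real.sin (θ j - β)) := by
  obtain ⟨bf, hbf⟩ := (h.isFrame_right hV).exists_basis
  obtain ⟨bw, hbw⟩ := hw.exists_basis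
  refine ⟨⟨bw.equivFun.symm ≪≫ₗ bf.equivFun, fun x => ?_⟩⟩
  set c := (bw.equivFun.symm ≪≫ₗ bf.equivFun) x with hc
  have hsum : ∑ i, x i • w i = ∑ j, c j • rot (θ j) (e j) := by
    have h1 : bw.equivFun.symm x = bf.equivFun.symm c := by simp [hc]
    have h2 := congrArg W.subtype h1
    simpa [Module.Basis.equivFun_symm_apply, hbf, hbw] using h2
  have htr : ∀ t, transverseMap V w t x = ∑ j, (c j * Real.sin (θ j - t)) • J k (e j) := by
    intro t
    have hPe : ∀ j, V.starProjection (e j) = e j := fun j =>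
      Submodule.starProjection_eq_self_iff.2 (h.isFrame_left.mem j)
    rw [transverseMap_apply, hsum]
    simp only [map_sum, map_smul, rot_rot, neg_add_eq_sub, ← Finset.sum_sub_distrib]
    refine Finset.sum_congr rfl fun j _ => ?_
    simp only [rot_apply, map_add, map_smul, hV.starProjection_J, hPe]
    module
  change QuadraticMap.weightedSumSquares ℝ _ c = angleForm V w α β x
  rw [angleForm_apply, htr, htr, QuadraticMap.weightedSumSquares_apply]
  simp only [sum_inner, inner_sum, inner_smul_left, inner_smul_right, h.inner_J]
  simp
  exact Finset.sum_congr rfl fun j _ => by ring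

lemma sin_mul_sin_neg_iff {x α β : ℝ} (hx0 : 0 ≤ x) (hx : x < Real.pi) (hα : 0 < α)
    (hαβ : α < β) (hβ : β < Real.pi) :
    Real.sin (x - α) * Real.sin (x - β) < 0 ↔ α < x ∧ x < β := by
  have hneg : ∀ t, 0 < t → t < Real.pi → x < t → Real.sin (x - t) < 0 := fun t h0 h1 h2 =>
    Real.sin_neg_of_neg_of_neg_pi_lt (by linarith) (by linarith)
  have hpos : ∀ t, 0 < t → t < Real.pi → t ≤ x → 0 ≤ Real.sin (x - t) := fun t h0 h1 h2 =>
    Real.sin_nonneg_of_nonneg_of_le_pi (by linarith) (by linarith)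
  constructor
  · intro hlt
    refine ⟨?_, ?_⟩ <;> by_contra! hcon
    · rcases hcon.lt_or_eq with h' | rfl
      · exact hlt.not_gt (mul_pos_of_neg_of_neg (hneg α hα (by linarith) h')
          (hneg β (by linarith) hβ (by linarith)))
      · simp at hlt
    · exact hlt.not_ge (mul_nonneg (hpos α hα (by linarith) (by linarith))
        (hpos β (by linarith) hβ hcon))
  · rintro ⟨h1, h2⟩
    exact mul_neg_of_pos_of_neg (Real.sin_pos_of_pos_of_lt_pi (by linarith) (by linarith))
      (hneg β (by linarith) hβ h2)

end IsAngleFrame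

lemma angleCount_add_sigNeg
    {V W : Submodule ℝ (Space k k)} (hV : IsLagrangian V) (hW : IsLagrangian W)
    {w : Fin k → Space k k} (hw : IsFrame w W) {α β : ℝ} (hα : 0 < α) (hαβ : α < β)
    (hβ : β < Real.pi) (hVWα : V ⊓ rotated α W = ⊥) :
    angleCount V W α + sigNeg (angleForm V w α β) = angleCount V W β := by
  obtain ⟨e, θ, h⟩ := exists_isAngleFrame hV hW
  have hα' := hαβ.trans hβ
  rw [h.inf_rotated_eq_bot_iff hV hα.le hα'] at hVWα
  rw [QuadraticForm.sigNeg_of_equiv_weightedSumSquares (h.equivalent_angleForm hV hw α β),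
    h.angleCount_eq hV hα'.le, h.angleCount_eq hV hβ.le]
  have hset : {j | Real.sin (θ j - α) * Real.sin (θ j - β) < 0} =
      ((Finset.univ.filter fun j => α < θ j ∧ θ j < β : Finset (Fin k)) : Set (Fin k)) := by
    ext j
    simp [IsAngleFrame.sin_mul_sin_neg_iff (h.nonneg j) (h.lt_pi j) hα hαβ hβ]
  rw [hset, ncard_coe_finset, ← Finset.card_union_of_disjoint]
  · congr 1
    ext j
    simp only [Finset.mem_union, Finset.mem_filter, Finset.mem_univ, true_and]
    constructor
    · rintro (h | h) <;> constructor <;> linarith [h.1, h.2]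
    · rintro ⟨h1, h2⟩
      rcases (hVWα j).lt_or_gt with h3 | h3
      · exact Or.inl ⟨h1, h3⟩
      · exact Or.inr ⟨h3, h2⟩
  · rw [Finset.disjoint_filter]
    rintro j - h1 h2
    linarith [h1.2, h2.1]

/-- The form is nondegenerate: a diagonal entry vanishes only if some angle equals `α` or `β`. -/
lemma le_sigPos_add_sigNeg_angleForm
    {V W : Submodule ℝ (Space k k)} (hV : IsLagrangian V) (hW : IsLagrangian W)
    {w : Fin k → Space k k} (hw : IsFrame w W) {α β : ℝ} (hα : 0 < α) (hαβ : α < β)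
    (hβ : β < Real.pi) (hVWα : V ⊓ rotated α W = ⊥)
    (hVWβ : V ⊓ rotated β W = ⊥) :
    k ≤ sigPos (angleForm V w α β) +
      sigNeg (angleForm V w α β) := by
  obtain ⟨e, θ, h⟩ := exists_isAngleFrame hV hW
  have hα' := hαβ.trans hβ
  rw [h.inf_rotated_eq_bot_iff hV hα.le hα'] at hVWα
  rw [h.inf_rotated_eq_bot_iff hV (hα.trans hαβ).le hβ] at hVWβ
  have heq := h.equivalent_angleForm hV hw α β
  rw [QuadraticForm.sigNeg_of_equiv_weightedSumSquares heq,
    QuadraticForm.sigPos_of_equiv_weightedSumSquares heq]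
  have hset : {j | Real.sin (θ j - α) * Real.sin (θ j - β) < 0} =
      {j | 0 < Real.sin (θ j - α) * Real.sin (θ j - β)}ᶜ := by
    ext j
    have hne : Real.sin (θ j - α) * Real.sin (θ j - β) ≠ 0 := by
      rw [mul_ne_zero_iff, Ne, Ne, sin_sub_eq_zero_iff (h.nonneg j) (h.lt_pi j) hα.le hα',
        sin_sub_eq_zero_iff (h.nonneg j) (h.lt_pi j) (hα.trans hαβ).le hβ]
      exact ⟨hVWα j, hVWβ j⟩
    simp only [mem_ofPred_eq, mem_compl_iff, not_lt]
    exact ⟨le_of_lt, fun h => lt_of_le_of_ne h hne⟩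
  rw [hset, ncard_add_ncard_compl, Nat.card_fin]

/-! ### Dependence on the time parameter -/

section Paths

variable {T : Type*} [TopologicalSpace T] {V W : T → Lag k} {v w : T → Fin k → Space k k}

lemma continuous_rot (t : ℝ) : Continuous (rot t : Space k k →ₗ[ℝ] Space k k) :=
  LinearMap.continuous_of_finiteDimensional _

lemma continuous_rotDet (hvc : Continuous v) (hwc : Continuous w) (t : ℝ) :
    Continuous fun s => rotDet (v s) (w s) t := by
  refine Continuous.matrix_det (continuous_matrix fun r c => ?_)
  rcases c with c | c
  · exact (EuclideanSpace.proj (𝕜 := ℝ) r).continuous.comp ((continuous_apply c).comp hvc)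
  · exact (EuclideanSpace.proj (𝕜 := ℝ) r).continuous.comp
      ((continuous_rot _).comp ((continuous_apply c).comp hwc))

lemma continuous_transverseMap (hV : Continuous V) (hwc : Continuous w) (t : ℝ) :
    Continuous fun p : T × (Fin k → ℝ) =>
      transverseMap (V p.1).toSubspace (w p.1) t p.2 := by
  simp only [transverseMap_apply]
  have h1 : Continuous fun p : T × (Fin k → ℝ) => rot (-t) (∑ i, p.2 i • w p.1 i) := by
    refine (continuous_rot _).comp (continuous_finsetSum _ fun i _ => ?_)
    exact ((continuous_apply i).comp continuous_snd).smul
      ((continuous_apply i).comp (hwc.comp continuous_fst))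
  exact h1.sub (((continuous_starProjection.comp hV).comp continuous_fst).clm_apply h1)

lemma continuous_angleForm (hV : Continuous V) (hwc : Continuous w) (α β : ℝ) :
    Continuous fun p : T × (Fin k → ℝ) =>
      angleForm (V p.1).toSubspace (w p.1) α β p.2 := by
  simp only [angleForm_apply]
  exact (continuous_transverseMap hV hwc α).inner (continuous_transverseMap hV hwc β)

lemma isOpen_setOf_inf_rotated_eq_bot (hvc : Continuous v) (hwc : Continuous w)
    (hv : ∀ s, IsFrame (v s) (V s).toSubspace) (hw : ∀ s, IsFrame (w s) (W s).toSubspace)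
    {t : ℝ} (ht0 : 0 < t) (ht : t < Real.pi) :
    IsOpen {s | (V s).toSubspace ⊓ rotated t (W s).toSubspace = ⊥} := by
  have hset : {s | (V s).toSubspace ⊓ rotated t (W s).toSubspace = ⊥} =
      {s | rotDet (v s) (w s) t ≠ 0} := by
    ext s
    exact (rotDet_ne_zero_iff (V s).2 (W s).2 (hv s) (hw s) ht0.le ht).symm
  rw [hset]
  exact isOpen_ne_fun (continuous_rotDet hvc hwc t) continuous_const

/-- The number of angles between two levels is locally constant, as long as no angle is equal to
one of the levels. -/
lemma continuousAt_angleCount_sub (hV : Continuous V) (hvc : Continuous v)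
    (hwc : Continuous w) (hv : ∀ s, IsFrame (v s) (V s).toSubspace)
    (hw : ∀ s, IsFrame (w s) (W s).toSubspace) {α β : ℝ} (hα0 : 0 < α) (hα : α < Real.pi)
    (hβ0 : 0 < β) (hβ : β < Real.pi) {s₀ : T}
    (hsα : (V s₀).toSubspace ⊓ rotated α (W s₀).toSubspace = ⊥)
    (hsβ : (V s₀).toSubspace ⊓ rotated β (W s₀).toSubspace = ⊥) :
    ContinuousAt (fun s => (angleCount (V s).toSubspace (W s).toSubspace β : ℤ) -
      angleCount (V s).toSubspace (W s).toSubspace α) s₀ := by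
  wlog hαβ : α < β generalizing α β
  · rcases (not_lt.1 hαβ).lt_or_eq with h | rfl
    · exact (this hβ0 hβ hα0 hα hsβ hsα h).neg.congr (.of_forall fun s => neg_sub _ _)
    · simpa using continuousAt_const
  have hev1 := (isOpen_setOf_inf_rotated_eq_bot hvc hwc hv hw hα0 hα).eventually_mem hsα
  have hev2 := eventually_sigNeg_eq (q := fun s => angleForm (V s).toSubspace (w s) α β)
    (continuous_angleForm hV hwc α β)
    (le_sigPos_add_sigNeg_angleForm (V s₀).2 (W s₀).2 (hw s₀) hα0 hαβ hβ hsα hsβ)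
  refine (continuousAt_const (y := (sigNeg (angleForm (V s₀).toSubspace (w s₀) α β) : ℤ))).congr ?_
  filter_upwards [hev1, hev2] with s h1 h2
  have h3 := angleCount_add_sigNeg (V s).2 (W s).2 (hw s) hα0 hαβ hβ h1
  change angleCount (V s).toSubspace (W s).toSubspace α +
    sigNeg (angleForm (V s).toSubspace (w s) α β) =
      angleCount (V s).toSubspace (W s).toSubspace β at h3
  omega

end Paths

/-! ### Existence and uniqueness of the Maslov index -/

variable {a b : ℝ}

lemma isPreconnected_Icc_subtype (x y : Icc a b) : IsPreconnected (Icc x y) := by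
  rw [← Topology.IsInducing.subtypeVal.isPreconnected_image]
  have : Subtype.val '' Icc x y = Icc (x : ℝ) y := by
    ext r
    constructor
    · rintro ⟨s, hs, rfl⟩; exact hs
    · intro hr
      exact ⟨⟨r, x.2.1.trans hr.1, hr.2.trans y.2.2⟩, hr, rfl⟩
  rw [this]
  exact isPreconnected_Icc

/-- At each time a pair has finitely many angles, so some level is free; it stays free nearby, and
compactness gives the subdivision. -/
lemma exists_isMaslovIndexCLM (hab : a ≤ b) {V W : Icc a b → Lag k} (hV : Continuous V)
    (hW : Continuous W) :
    ∃ m, IsMaslovIndexCLM hab (fun s => (V s).toSubspace) (fun s => (W s).toSubspace) m := by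
  obtain ⟨v, hvc, hv⟩ := exists_continuous_frame hab hV
  obtain ⟨w, hwc, hw⟩ := exists_continuous_frame hab hW
  choose ε hε0 hε hdet using fun s => exists_rotDet_ne_zero (V s).2 (W s).2 (hv s) (hw s)
  have hbot := fun s =>
    (rotDet_ne_zero_iff (V s).2 (W s).2 (hv s) (hw s) (hε0 s).le (hε s)).1 (hdet s)
  obtain ⟨t, ht0, htm, ⟨n, hn⟩, htc⟩ := exists_monotone_Icc_subset_open_cover_Icc hab
    (fun i => isOpen_setOf_inf_rotated_eq_bot hvc hwc hv hw (hε0 i) (hε i))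
    (fun s _ => mem_iUnion.2 ⟨s, hbot s⟩)
  choose i hi using htc
  exact ⟨_, n, t, fun j => ε (i j), htm, Subtype.ext ht0, Subtype.ext (hn n le_rfl),
    fun j _ => ⟨hε0 _, hε _, fun s h1 h2 => hi j ⟨h1, h2⟩⟩, rfl⟩

/-- Over a subdivision, the local changes of the angle counts add up to a function on the whole
interval. -/
lemma exists_continuousWithinAt_sub_angleCount {V W : Icc a b → Lag k}
    {v w : Icc a b → Fin k → Space k k} (hV : Continuous V) (hvc : Continuous v)
    (hwc : Continuous w) (hv : ∀ s, IsFrame (v s) (V s).toSubspace)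
    (hw : ∀ s, IsFrame (w s) (W s).toSubspace) {t : ℕ → Icc a b} {ε : ℕ → ℝ}
    (htm : Monotone t) (hta : ∀ s, t 0 ≤ s) (n : ℕ)
    (ht : ∀ j < n, 0 < ε j ∧ ε j < Real.pi ∧ ∀ s, t j ≤ s → s ≤ t (j + 1) →
      (V s).toSubspace ⊓ rotated (ε j) (W s).toSubspace = ⊥) :
    ∃ F : Icc a b → ℤ, ∀ s₀, ∀ δ, 0 < δ → δ < Real.pi →
      (V s₀).toSubspace ⊓ rotated δ (W s₀).toSubspace = ⊥ →
      ContinuousWithinAt (fun s => F s - angleCount (V s).toSubspace (W s).toSubspace δ)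
        (Iic (t n)) s₀ := by
  induction n with
  | zero =>
    refine ⟨0, fun s₀ δ _ _ _ => ?_⟩
    have : Iic (t 0) = {t 0} := by
      ext s
      exact ⟨fun h => le_antisymm h (hta s), fun h => le_of_eq h⟩
    rw [this]
    by_cases hs : s₀ = t 0
    · subst hs
      exact continuousWithinAt_singleton
    · exact continuousWithinAt_of_notMem_closure (by simpa using hs)
  | succ n ih =>
    obtain ⟨F, hF⟩ := ih fun j hj => ht j (by omega)
    obtain ⟨hε0, hε, hbot⟩ := ht n n.lt_succ_self
    have hle : t n ≤ t (n + 1) := htm n.le_succ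
    let c : Icc a b → ℝ → ℤ := fun s δ => angleCount (V s).toSubspace (W s).toSubspace δ
    -- Beyond `t n` the function follows the count at level `ε n`, shifted to agree with `F` at `t
    -- n`. On the new piece, the difference from the count at `δ` is a count between two levels, up
    -- to a constant and sign.
    refine ⟨fun s => if s ≤ t n then F s else F (t n) - c (t n) (ε n) + c s (ε n),
      fun s₀ δ hδ0 hδ hs₀ => ?_⟩
    rw [← Iic_union_Icc_eq_Iic hle]
    refine ContinuousWithinAt.union ?_ ?_
    · by_cases hs : s₀ ≤ t n
      · exact (hF s₀ δ hδ0 hδ hs₀).congr (fun s h => by simp only [if_pos (show s ≤ t n from h)])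
          (by simp only [if_pos hs])
      · exact continuousWithinAt_of_notMem_closure (by rwa [isClosed_Iic.closure_eq, mem_Iic])
    · by_cases hs : s₀ ∈ Icc (t n) (t (n + 1))
      · have h1 := ((continuousAt_angleCount_sub hV hvc hwc hv hw hδ0 hδ hε0 hε hs₀
          (hbot s₀ hs.1 hs.2)).const_add (F (t n) - c (t n) (ε n))).continuousWithinAt
          (s := Icc (t n) (t (n + 1)))
        have h2 : ∀ s ∈ Icc (t n) (t (n + 1)),
            (if s ≤ t n then F s else F (t n) - c (t n) (ε n) + c s (ε n)) - c s δ =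
              F (t n) - c (t n) (ε n) + (c s (ε n) - c s δ) := by
          intro s h
          split_ifs with h'
          · rw [le_antisymm h' h.1]; ring
          · ring
        exact h1.congr h2 (h2 s₀ hs)
      · exact continuousWithinAt_of_notMem_closure (by rwa [isClosed_Icc.closure_eq])

/-- The Maslov index is the increment of a function that changes locally like the angle counts. -/
lemma IsMaslovIndexCLM.eq_sub {hab : a ≤ b} {V W : Icc a b → Lag k} {F : Icc a b → ℤ}
    (hF : ∀ s₀, ∀ δ, 0 < δ → δ < Real.pi →
      (V s₀).toSubspace ⊓ rotated δ (W s₀).toSubspace = ⊥ →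
      ContinuousAt (fun s => F s - angleCount (V s).toSubspace (W s).toSubspace δ) s₀) {m : ℤ}
    (hm : IsMaslovIndexCLM hab (fun s => (V s).toSubspace) (fun s => (W s).toSubspace) m) :
    m = F ⟨b, right_mem_Icc.2 hab⟩ - F ⟨a, left_mem_Icc.2 hab⟩ := by
  obtain ⟨n, t, ε, htm, hta, htb, ht, rfl⟩ := hm
  rw [← hta, ← htb, ← Finset.sum_range_sub fun j => F (t j)]
  refine Finset.sum_congr rfl fun j hj => ?_
  obtain ⟨hε0, hε, hbot⟩ := ht j (Finset.mem_range.1 hj)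
  have hle : t j ≤ t (j + 1) := htm j.le_succ
  have h1 := (isPreconnected_Icc_subtype (t j) (t (j + 1))).constant
    (fun s hs => (hF s (ε j) hε0 hε (hbot s hs.1 hs.2)).continuousWithinAt)
    (left_mem_Icc.2 hle) (right_mem_Icc.2 hle)
  linarith

lemma IsMaslovIndexCLM.unique {hab : a ≤ b} {V W : Icc a b → Lag k} (hV : Continuous V)
    (hW : Continuous W) {m m' : ℤ}
    (hm : IsMaslovIndexCLM hab (fun s => (V s).toSubspace) (fun s => (W s).toSubspace) m)
    (hm' : IsMaslovIndexCLM hab (fun s => (V s).toSubspace) (fun s => (W s).toSubspace) m') :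
    m = m' := by
  obtain ⟨v, hvc, hv⟩ := exists_continuous_frame hab hV
  obtain ⟨w, hwc, hw⟩ := exists_continuous_frame hab hW
  have hm₁ := hm
  obtain ⟨n, t, ε, htm, hta, htb, ht, -⟩ := hm₁
  obtain ⟨F, hF⟩ := exists_continuousWithinAt_sub_angleCount hV hvc hwc hv hw htm
    (fun s => by rw [hta]; exact s.2.1) n ht
  have hF' : ∀ s₀, ∀ δ, 0 < δ → δ < Real.pi →
      (V s₀).toSubspace ⊓ rotated δ (W s₀).toSubspace = ⊥ →
      ContinuousAt (fun s => F s - angleCount (V s).toSubspace (W s).toSubspace δ) s₀ := by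
    intro s₀ δ h0 h1 h2
    have huniv : Iic (t n) = univ := by
      rw [htb]
      exact eq_univ_of_forall fun s => s.2.2
    rw [← continuousWithinAt_univ, ← huniv]
    exact hF s₀ δ h0 h1 h2
  rw [hm.eq_sub hF', hm'.eq_sub hF']

/-! ### Parity and the `ℤ₂`-index -/

lemma mul_pos_of_continuousOn {s : Set (Icc a b)} (hs : IsPreconnected s) {f : Icc a b → ℝ}
    (hf : ContinuousOn f s) (h0 : ∀ x ∈ s, f x ≠ 0) {x y : Icc a b} (hx : x ∈ s) (hy : y ∈ s) :
    0 < f x * f y := by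
  by_contra! hcon
  have hne := mul_ne_zero (h0 x hx) (h0 y hy)
  have : ∃ z ∈ s, f z = 0 := by
    rcases mul_neg_iff.1 (lt_of_le_of_ne hcon hne) with ⟨h1, h2⟩ | ⟨h1, h2⟩
    · exact hs.intermediate_value hy hx hf ⟨h2.le, h1.le⟩
    · exact hs.intermediate_value hx hy hf ⟨h1.le, h2.le⟩
  obtain ⟨z, hz, hz0⟩ := this
  exact h0 z hz hz0

/-- The parity of the Maslov index is the change of the sign of `det [v | w]`, for all continuous
frames `v` and `w`. -/
lemma IsMaslovIndexCLM.det_mul_pos {hab : a ≤ b} {V W : Icc a b → Lag k}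
    {v w : Icc a b → Fin k → Space k k} (hvc : Continuous v)
    (hwc : Continuous w) (hv : ∀ s, IsFrame (v s) (V s).toSubspace)
    (hw : ∀ s, IsFrame (w s) (W s).toSubspace) {m : ℤ}
    (hm : IsMaslovIndexCLM hab (fun s => (V s).toSubspace) (fun s => (W s).toSubspace) m)
    (ha : Transversal (V ⟨a, left_mem_Icc.2 hab⟩).toSubspace
      (W ⟨a, left_mem_Icc.2 hab⟩).toSubspace)
    (hb : Transversal (V ⟨b, right_mem_Icc.2 hab⟩).toSubspace
      (W ⟨b, right_mem_Icc.2 hab⟩).toSubspace) :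
    0 < (frameMatrix (v ⟨a, left_mem_Icc.2 hab⟩) (w ⟨a, left_mem_Icc.2 hab⟩) *
      frameMatrix (v ⟨b, right_mem_Icc.2 hab⟩) (w ⟨b, right_mem_Icc.2 hab⟩)).det *
        (-1 : ℝ) ^ m := by
  obtain ⟨n, t, ε, htm, hta, htb, ht, rfl⟩ := hm
  choose κ hκ hκT using fun s => exists_sign (V := (V s).toSubspace)
    (W := (W s).toSubspace) (V s).2 (W s).2 (hv s) (hw s)
  have hane := hκT _ ha
  have hbne := hκT _ hb
  have key : ∀ i ≤ n, 0 < κ (t 0) * κ (t i) * (-1 : ℝ) ^ (∑ j ∈ Finset.range i,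
      ((angleCount (V (t (j + 1))).toSubspace (W (t (j + 1))).toSubspace (ε j) : ℤ)
        - (angleCount (V (t j)).toSubspace (W (t j)).toSubspace (ε j) : ℤ))) := by
    intro i
    induction i with
    | zero =>
      intro _
      rw [← hta] at hane
      simpa using left_ne_zero_of_mul hane.ne'
    | succ i ih =>
      intro hi
      obtain ⟨hε0, hε, hbot⟩ := ht i (by omega)
      have hle : t i ≤ t (i + 1) := htm i.le_succ
      have h1 := ih (by omega)
      have h2 := hκ (t i) (ε i) hε0 hε (hbot _ le_rfl hle)
      have h3 := hκ (t (i + 1)) (ε i) hε0 hε (hbot _ hle le_rfl)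
      have h4 := mul_pos_of_continuousOn (isPreconnected_Icc_subtype (t i) (t (i + 1)))
        (continuous_rotDet hvc hwc (ε i)).continuousOn
        (fun s hs => (rotDet_ne_zero_iff (V s).2 (W s).2 (hv s) (hw s) hε0.le hε).2
          (hbot s hs.1 hs.2)) (left_mem_Icc.2 hle) (right_mem_Icc.2 hle)
      rw [Finset.sum_range_succ, zpow_add₀ (by norm_num), zpow_sub₀ (by norm_num),
        zpow_natCast, zpow_natCast, div_eq_mul_inv, ← inv_pow, inv_neg_one]
      set p := (-1 : ℝ) ^ (∑ j ∈ Finset.range i,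
        ((angleCount (V (t (j + 1))).toSubspace (W (t (j + 1))).toSubspace (ε j) : ℤ)
          - (angleCount (V (t j)).toSubspace (W (t j)).toSubspace (ε j) : ℤ)))
      set q := (-1 : ℝ) ^ angleCount (V (t i)).toSubspace (W (t i)).toSubspace (ε i)
      set r := (-1 : ℝ) ^ angleCount (V (t (i + 1))).toSubspace (W (t (i + 1))).toSubspace (ε i)
      have h5 := mul_pos (mul_pos h1 (mul_pos h2 h3)) h4
      -- The product `h5` of the known positive quantities is the claim times this square.
      have hsq : 0 ≤ (κ (t i) * rotDet (v (t i)) (w (t i)) (ε i) *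
        rotDet (v (t (i + 1))) (w (t (i + 1))) (ε i)) ^ 2 := sq_nonneg _
      refine pos_of_mul_pos_right (a := (κ (t i) * rotDet (v (t i)) (w (t i)) (ε i) *
        rotDet (v (t (i + 1))) (w (t (i + 1))) (ε i)) ^ 2) ?_ hsq
      convert h5 using 1
      ring
  have h1 := key n le_rfl
  rw [hta, htb] at h1
  rw [Matrix.det_mul]
  have h2 := mul_pos (mul_pos hane hbne) h1
  refine pos_of_mul_pos_right (a := (κ ⟨a, left_mem_Icc.2 hab⟩ * κ ⟨b, right_mem_Icc.2 hab⟩) ^ 2)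
    ?_ (sq_nonneg _)
  convert h2 using 1
  ring

lemma IsZ2Index.modEq {hab : a ≤ b} {V W : Icc a b → Lag k} {i m : ℤ}
    (hi : IsZ2Index hab (fun s => (V s).toSubspace) (fun s => (W s).toSubspace) i)
    (hm : IsMaslovIndexCLM hab (fun s => (V s).toSubspace) (fun s => (W s).toSubspace) m)
    (ha : Transversal (V ⟨a, left_mem_Icc.2 hab⟩).toSubspace
      (W ⟨a, left_mem_Icc.2 hab⟩).toSubspace)
    (hb : Transversal (V ⟨b, right_mem_Icc.2 hab⟩).toSubspace
      (W ⟨b, right_mem_Icc.2 hab⟩).toSubspace) : i ≡ m [ZMOD 2] := by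
  obtain ⟨v, w, hvc, hwc, hv, hw, h⟩ := hi
  have hpos := hm.det_mul_pos hvc hwc hv hw ha hb
  rcases Int.even_or_odd m with hm2 | hm2
  · rw [hm2.neg_one_zpow, mul_one] at hpos
    rcases h with ⟨-, rfl⟩ | ⟨h, -⟩
    · exact (Int.even_iff.1 hm2).symm
    · exact absurd h hpos.not_gt
  · rw [hm2.neg_one_zpow] at hpos
    rcases h with ⟨h, -⟩ | ⟨-, rfl⟩
    · linarith
    · exact (Int.odd_iff.1 hm2).symm

lemma exists_isZ2Index (hab : a ≤ b) {V W : Icc a b → Lag k} (hV : Continuous V)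
    (hW : Continuous W)
    (ha : Transversal (V ⟨a, left_mem_Icc.2 hab⟩).toSubspace
      (W ⟨a, left_mem_Icc.2 hab⟩).toSubspace)
    (hb : Transversal (V ⟨b, right_mem_Icc.2 hab⟩).toSubspace
      (W ⟨b, right_mem_Icc.2 hab⟩).toSubspace) :
    ∃ i, IsZ2Index hab (fun s => (V s).toSubspace) (fun s => (W s).toSubspace) i := by
  obtain ⟨v, hvc, hv⟩ := exists_continuous_frame hab hV
  obtain ⟨w, hwc, hw⟩ := exists_continuous_frame hab hW
  have hane := (hv _).det_ne_zero (hw _) (inf_eq_bot_of_transversal (V _).2 (W _).2 ha)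
  have hbne := (hv _).det_ne_zero (hw _) (inf_eq_bot_of_transversal (V _).2 (W _).2 hb)
  have hne := mul_ne_zero hane hbne
  rw [← Matrix.det_mul] at hne
  rcases hne.lt_or_gt with h | h
  · exact ⟨1, v, w, hvc, hwc, hv, hw, Or.inr ⟨h, rfl⟩⟩
  · exact ⟨0, v, w, hvc, hwc, hv, hw, Or.inl ⟨h, rfl⟩⟩

lemma IsZ2Index.eq_zero_or_eq_one {l : ℕ} {hab : a ≤ b} {V W : Icc a b → Submodule ℝ (Space k l)}
    {i : ℤ} (hi : IsZ2Index hab V W i) : i = 0 ∨ i = 1 := by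
  obtain ⟨v, w, -, -, -, -, ⟨-, h⟩ | ⟨-, h⟩⟩ := hi
  · exact Or.inl h
  · exact Or.inr h

end LagrangianPaths

end

theorem proposition2p1 (k : ℕ) (a b : ℝ) (hab : a ≤ b)
    (Z : C(Set.Icc a b, LagrangianPaths.Lag k × LagrangianPaths.Lag k))
    (ha : LagrangianPaths.Transversal (Z ⟨a, Set.left_mem_Icc.2 hab⟩).1.toSubspace
      (Z ⟨a, Set.left_mem_Icc.2 hab⟩).2.toSubspace)
    (hb : LagrangianPaths.Transversal (Z ⟨b, Set.right_mem_Icc.2 hab⟩).1.toSubspace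
      (Z ⟨b, Set.right_mem_Icc.2 hab⟩).2.toSubspace) :
    (∃! i : ℤ, LagrangianPaths.IsZ2Index hab
      (fun t => (Z t).1.toSubspace) (fun t => (Z t).2.toSubspace) i) ∧
    (∃! m : ℤ, LagrangianPaths.IsMaslovIndexCLM hab
      (fun t => (Z t).1.toSubspace) (fun t => (Z t).2.toSubspace) m) ∧
    ∀ i m : ℤ,
      LagrangianPaths.IsZ2Index hab
        (fun t => (Z t).1.toSubspace) (fun t => (Z t).2.toSubspace) i →
      LagrangianPaths.IsMaslovIndexCLM hab
        (fun t => (Z t).1.toSubspace) (fun t => (Z t).2.toSubspace) m →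
      i ≡ m [ZMOD 2] := by
  have hV : Continuous fun t => (Z t).1 := continuous_fst.comp Z.continuous
  have hW : Continuous fun t => (Z t).2 := continuous_snd.comp Z.continuous
  obtain ⟨i, hi⟩ := LagrangianPaths.exists_isZ2Index hab hV hW ha hb
  obtain ⟨m, hm⟩ := LagrangianPaths.exists_isMaslovIndexCLM hab hV hW
  refine ⟨⟨i, hi, fun i' hi' => ?_⟩, ⟨m, hm, fun m' hm' => hm'.unique hV hW hm⟩,
    fun i m hi hm => hi.modEq hm ha hb⟩
  -- Both values are congruent to the same `m`, and both lie in `{0, 1}`.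
  have h : i' % 2 = i % 2 := (hi'.modEq hm ha hb).trans (hi.modEq hm ha hb).symm
  rcases hi.eq_zero_or_eq_one with rfl | rfl <;>
    rcases hi'.eq_zero_or_eq_one with rfl | rfl <;> simp_all
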